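/- Let $\mathbb F_q$ be a finite field with $q$ elements, let $F_1\subsetneq F_0\subseteq\mathbb F_q^n$ be linear codes, and let $G_E\in\mathbb F_q^{e\times n}$ be a matrix (not necessarily of full rank) whose row space $E$ satisfies $F_0\cap E=\{0\}$. Put $f_i=\dim F_i$ and $m=f_0-f_1$. Let $G_{F_1}$ be a generator matrix of $F_1$ (its rows form a basis of $F_1$), and let $G_{F_0/F_1}$ be a generator matrix of some complement of $F_1$ in $F_0$. The extended CSS code $\mathrm{ECSS}(F_0,F_1,G_E)$ encodes a secret of $m$ qudits of dimension $q$ into $n+e$ qudits of dimension $q$ by $$|\underline s\rangle\ \mapsto\ \frac1{\sqrt{q^{f_1+e}}}\sum_{\underline r_1\in\mathbb F_q^{f_1},\ \underline r_2\in\mathbb F_q^{e}}\bigl|G_{F_0/F_1}^T\underline s+G_{F_1}^T\underline r_1+G_E^T\underline r_2\bigr\rangle\,\bigl|\underline r_2\bigr\rangle ,\qquad \underline s\in\mathbb F_q^{m},$$ extended linearly. The first $n$ qudits are called the original qudits and the last $e$ the extension qudits. The secret can be recovered from a set of encoded qudits if there is a quantum channel (a completely positive trace preserving map) which, applied to the reduced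 state of the qudits in this set, returns the secret state, for every (pure or mixed) secret state. For linear codes $C_0\not\subseteq C_1$ write $\mathrm{wt}(C_0\setminus C_1)=\min\{\mathrm{wt}(\underline c): \underline c\in C_0,\ \underline c\notin C_1\}$, where $\mathrm{wt}(\underline c)$ is the Hamming weight, and let $C^\perp$ be the dual of $C$ with respect to the standard bilinear form on $\mathbb F_q^n$. **Corollary (Threshold with no access to extension qudits).** Let $\tau\ge 0$ be an integer. With access to none of the extension qudits, the secret can be recovered from every set of $\tau$ of the $n$ original qudits of $\mathrm{ECSS}(F_0,F_1,G_E)$ if and only if $\tau\ge\tau_0$, where $$\tau_0=n-\min\bigl\{\mathrm{wt}\bigl((F_0+E)\setminus(F_1+E)\bigr),\ \mathrm{wt}\bigl(F_1^\perp\setminus F_0^\perp\bigr)\bigr\}+1 .$$ -/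

import Mathlib

open scoped Matrix ComplexOrder

noncomputable section

namespace ExtendedCSS

/-! ### Linear codes -/

/-- The row space of a matrix `G` over `F`. -/
def rowSpace {F k ι : Type*} [Field F] (G : Matrix k ι F) : Submodule F (ι → F) :=
  Submodule.span F (Set.range G.row)

/-- `G` is a generator matrix of the linear code `C`: its rows form a basis of `C`. -/
def IsGeneratorMatrix {F k ι : Type*} [Field F] (G : Matrix k ι F)
    (C : Submodule F (ι → F)) : Prop :=
  LinearIndependent F G.row ∧ rowSpace G = C

/-- `G` is a matrix `G_{C₀/C₁}`: a generator matrix of some complement of `C₁` in `C₀`. -/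
def IsQuotientGeneratorMatrix {F k ι : Type*} [Field F] (G : Matrix k ι F)
    (C₀ C₁ : Submodule F (ι → F)) : Prop :=
  ∃ D : Submodule F (ι → F), C₁ ⊓ D = ⊥ ∧ C₁ ⊔ D = C₀ ∧ IsGeneratorMatrix G D

/-- The (Euclidean) dual code `C^⊥`. -/
def dualCode {F ι : Type*} [Field F] [Fintype ι] (C : Submodule F (ι → F)) :
    Submodule F (ι → F) where
  carrier := {x | ∀ c ∈ C, x ⬝ᵥ c = 0}
  add_mem' := by
    intro a b ha hb c hc
    rw [add_dotProduct, ha c hc, hb c hc, add_zero]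
  zero_mem' := by
    intro c _
    exact zero_dotProduct c
  smul_mem' := by
    intro r x hx c hc
    rw [smul_dotProduct, hx c hc, smul_zero]

/-- `wt(C₀ \ C₁)`: the minimum Hamming weight of a word of `C₀` which is not in `C₁`.
It is an honest minimum whenever `C₀` is not contained in `C₁`. -/
def wtDiff {F ι : Type*} [Field F] [DecidableEq F] [Fintype ι]
    (C₀ C₁ : Submodule F (ι → F)) : ℕ :=
  sInf {w : ℕ | ∃ c : ι → F, c ∈ C₀ ∧ c ∉ C₁ ∧ hammingNorm c = w}

/-! ### Qudits, partial trace, channels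

A register of qudits indexed by `ι`, each of dimension `|F|`, has the orthonormal computational
basis `|x⟩`, `x : ι → F`; operators on it are complex matrices indexed by `ι → F`. -/

/-- A density operator: positive semidefinite with trace one. -/
def IsDensity {α : Type*} [Fintype α] (ρ : Matrix α α ℂ) : Prop :=
  ρ.PosSemidef ∧ ρ.trace = 1

/-- The basis label of the whole register that is `x` on `J` and `y` off `J`. -/
def glue {F ι : Type*} [DecidableEq ι] (J : Finset ι)
    (x : {i // i ∈ J} → F) (y : {i // i ∉ J} → F) : ι → F :=
  fun i => if h : i ∈ J then x ⟨i, h⟩ else y ⟨i, h⟩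

/-- The state of the qudits in `J`: the partial trace over all qudits outside `J`. -/
def reducedState {F ι : Type*} [Fintype F] [Fintype ι] [DecidableEq ι] (J : Finset ι)
    (M : Matrix (ι → F) (ι → F) ℂ) :
    Matrix ({i // i ∈ J} → F) ({i // i ∈ J} → F) ℂ :=
  fun x x' => ∑ y : {i // i ∉ J} → F, M (glue J x y) (glue J x' y)

/-- A quantum channel (completely positive trace preserving map) between finite-dimensional
systems, in operator-sum form `ρ ↦ ∑ i, K i ρ (K i)†` with `∑ i, (K i)† K i = 1`. -/
structure QuantumChannel (α β : Type*) [Fintype α] [DecidableEq α] [Fintype β] where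
  numKraus : ℕ
  kraus : Fin numKraus → Matrix β α ℂ
  tracePreserving : ∑ i, (kraus i)ᴴ * kraus i = 1

/-- The action of a quantum channel on operators. -/
def QuantumChannel.apply {α β : Type*} [Fintype α] [DecidableEq α] [Fintype β]
    (R : QuantumChannel α β) (ρ : Matrix α α ℂ) : Matrix β β ℂ :=
  ∑ i, R.kraus i * ρ * (R.kraus i)ᴴ

/-- `J` is an authorized set of the encoding `V`, whose columns are the encoded basis states of
a secret with basis `σ`: one quantum channel, acting on the qudits in `J` only, recovers every
secret state `ρ` from its encoding `V ρ V†`. -/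
def IsAuthorized {F ι σ : Type*} [Fintype F] [DecidableEq F] [Fintype ι] [DecidableEq ι]
    [Fintype σ] (V : Matrix (ι → F) σ ℂ) (J : Finset ι) : Prop :=
  ∃ R : QuantumChannel ({i // i ∈ J} → F) σ,
    ∀ ρ : Matrix σ σ ℂ, IsDensity ρ → R.apply (reducedState J (V * ρ * Vᴴ)) = ρ

/-! ### CSS and extended CSS encodings -/

/-- The encoding of CSS`(C₀, C₁)` with `A = G_{C₀/C₁}` and `B = G_{C₁}`: its column `s` is the
normalized superposition of `|Aᵀ s + Bᵀ r⟩` over all `r`. -/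
def cssEncoding {F ι k l : Type*} [Field F] [Fintype F] [DecidableEq F] [Fintype ι]
    [Fintype k] [Fintype l] [DecidableEq l]
    (A : Matrix k ι F) (B : Matrix l ι F) : Matrix (ι → F) (k → F) ℂ :=
  fun x s => ((Real.sqrt (Fintype.card (l → F)) : ℝ) : ℂ)⁻¹ *
    ∑ r : l → F, if x = Aᵀ *ᵥ s + Bᵀ *ᵥ r then 1 else 0

/-- The encoding of ECSS`(F₀, F₁, G_E)` with `A = G_{F₀/F₁}` and `B = G_{F₁}`. It is the
encoding of CSS`(C₀, C₁)` with `G_{C₀/C₁} = [A 0]` and `G_{C₁} = [B 0; G_E I]`.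
The original qudits are indexed by `Sum.inl`, the extension qudits by `Sum.inr`. -/
def ecssEncoding {F : Type*} [Field F] [Fintype F] [DecidableEq F] {n e m f : ℕ}
    (A : Matrix (Fin m) (Fin n) F) (B : Matrix (Fin f) (Fin n) F)
    (GE : Matrix (Fin e) (Fin n) F) : Matrix (Fin n ⊕ Fin e → F) (Fin m → F) ℂ :=
  cssEncoding (Matrix.fromCols A 0) (Matrix.fromBlocks B 0 GE 1)

end ExtendedCSS

end

noncomputable section

namespace ExtendedCSS

/-! ### Reduced states and channels -/

/-! A set J is authorized for a CSS encoding exactly when no logical operator of type X or Z lives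
off J (`isAuthorized_cssEncoding_iff`). An X operator off J makes two encoded basis states look
alike on J; a Z operator off J does the same for two superpositions that differ in a relative sign.
Conversely, without Z operators the coset representatives can be chosen supported on J, and without
X operators the labels on J split linearly into the secret and a remainder to be discarded.

If J contains only original qudits, the extension coordinates are unconstrained. The X side then
sees only the projections F₀ + E and F₁ + E; on the Z side the identity block determines the
extension part from the original part, leaving F₁^⊥ and F₀^⊥ (`isAuthorized_ecssEncoding_iff`). The
threshold is a count of zeros: all τ-sets meet the support of every relevant word iff no such word
has τ zeros (`forall_exists_ne_zero_iff_lt_wtDiff`). -/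

theorem sum_glue {F ι M : Type*} [Fintype F] [Fintype ι] [DecidableEq ι] [AddCommMonoid M]
    (J : Finset ι) (φ : (ι → F) → M) :
    ∑ x : {i // i ∈ J} → F, ∑ y : {i // i ∉ J} → F, φ (glue J x y) = ∑ z, φ z := by
  rw [← Fintype.sum_prod_type' (f := fun x y => φ (glue J x y))]
  exact Fintype.sum_equiv (Equiv.piEquivPiSubtypeProd (· ∈ J) (fun _ => F)).symm _ _
    fun _ => rfl

theorem glue_add {F ι : Type*} [Add F] [DecidableEq ι] (J : Finset ι)
    (x x' : {i // i ∈ J} → F) (y y' : {i // i ∉ J} → F) :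
    glue J (x + x') (y + y') = glue J x y + glue J x' y' := by
  ext i
  by_cases h : i ∈ J <;> simp [glue, h]

theorem glue_restrict {F ι : Type*} [DecidableEq ι] (J : Finset ι) (z : ι → F) :
    glue J (fun i => z i) (fun i => z i) = z := by
  ext i
  by_cases h : i ∈ J <;> simp [glue, h]

theorem reducedState_conj_apply {F ι σ : Type*} [Fintype F] [Fintype ι] [DecidableEq ι]
    [Fintype σ] (J : Finset ι) (V : Matrix (ι → F) σ ℂ) (ρ : Matrix σ σ ℂ)
    (x x' : {i // i ∈ J} → F) :
    reducedState J (V * ρ * Vᴴ) x x' =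
      ∑ s, ∑ s', ρ s s' * ∑ y, V (glue J x y) s * star (V (glue J x' y) s') := by
  simp only [reducedState, Matrix.mul_apply, Matrix.conjTranspose_apply, Finset.sum_mul,
    Finset.mul_sum]
  rw [Finset.sum_comm]
  rw [Finset.sum_comm]
  refine (Finset.sum_congr rfl fun y _ => Finset.sum_comm).trans ?_
  rw [Finset.sum_comm]
  refine Finset.sum_congr rfl fun s _ => ?_
  rw [Finset.sum_comm]
  refine Finset.sum_congr rfl fun s' _ => Finset.sum_congr rfl fun y _ => ?_
  ring

/-- The channel which discards the second factor of a system with basis `σ × τ`. -/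
def discardChannel {α σ τ : Type*} [Fintype α] [DecidableEq α] [Fintype σ] [Fintype τ]
    (f : σ × τ ≃ α) : QuantumChannel α σ where
  numKraus := Fintype.card τ
  -- After relabelling by `f`, this is the identity on σ tensored with the bra of the i-th basis
  -- label of τ.
  kraus i := Matrix.of fun s x => if x = f (s, (Fintype.equivFin τ).symm i) then 1 else 0
  tracePreserving := by
    classical
    rw [← (Fintype.equivFin τ).sum_comp]
    ext x x'
    simp only [Equiv.symm_apply_apply, Matrix.sum_apply, Matrix.mul_apply,
      Matrix.conjTranspose_apply, Matrix.one_apply, Matrix.of_apply]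
    obtain ⟨⟨s, t⟩, rfl⟩ := f.surjective x
    obtain ⟨⟨s', t'⟩, rfl⟩ := f.surjective x'
    simp only [EmbeddingLike.apply_eq_iff_eq, Prod.mk.injEq]
    rw [Finset.sum_eq_single t _ (by simp), Finset.sum_eq_single s _ (by simp)]
    · by_cases h : s' = s ∧ t' = t
      · simp [h]
      · have h' : ¬ (s = s' ∧ t = t') := by tauto
        simp [h, h']
    · intro b _ hb
      simp [hb.symm]
    · intro b _ hb
      simp [hb.symm]

theorem discardChannel_apply {α σ τ : Type*} [Fintype α] [DecidableEq α] [Fintype σ]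
    [Fintype τ] (f : σ × τ ≃ α) (ρ : Matrix α α ℂ) (s s' : σ) :
    (discardChannel f).apply ρ s s' = ∑ t, ρ (f (s, t)) (f (s', t)) := by
  have h : (discardChannel f).apply ρ = ∑ i : Fin (Fintype.card τ),
      (discardChannel f).kraus i * ρ * ((discardChannel f).kraus i)ᴴ := rfl
  rw [h, ← (Fintype.equivFin τ).sum_comp]
  simp [Matrix.sum_apply, Matrix.mul_apply, discardChannel]

theorem isDensity_half_vecMulVec {σ : Type*} [Fintype σ] [DecidableEq σ] {s t : σ}
    (h : s ≠ t) {c : ℂ} (hc : c * star c = 1) :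
    IsDensity ((1 / 2 : ℂ) • Matrix.vecMulVec (Pi.single s 1 + Pi.single t c)
      (star (Pi.single s 1 + Pi.single t c : σ → ℂ))) := by
  refine ⟨(Matrix.posSemidef_vecMulVec_self_star _).smul (by positivity), ?_⟩
  rw [Matrix.trace_smul, Matrix.trace_vecMulVec]
  simp only [dotProduct, Pi.add_apply, Pi.star_apply, star_add, Pi.single_apply]
  have : ∀ i : σ, ((if i = s then (1 : ℂ) else 0) + if i = t then c else 0) *
      (star (if i = s then (1 : ℂ) else 0) + star (if i = t then c else 0)) =
      (if i = s then 1 else 0) + if i = t then 1 else 0 := by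
    intro i
    by_cases h1 : i = s
    · subst h1; simp [h]
    · by_cases h2 : i = t
      · simp only [h2, if_true, if_false, h.symm, zero_add, star_zero, hc]
      · simp [h1, h2]
  simp only [this, Finset.sum_add_distrib, Finset.sum_ite_eq', Finset.mem_univ, if_true]
  norm_num

theorem isDensity_vecMulVec_single {σ : Type*} [Fintype σ] [DecidableEq σ] (s : σ) :
    IsDensity (Matrix.vecMulVec (Pi.single s (1 : ℂ)) (star (Pi.single s (1 : ℂ)))) := by
  refine ⟨Matrix.posSemidef_vecMulVec_self_star _, ?_⟩
  rw [Matrix.trace_vecMulVec]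
  simp

/-- The source of both necessary conditions: a single channel cannot send one reduced state to two
different secrets. -/
theorem IsAuthorized.eq_of_reducedState_eq {F ι σ : Type*} [Fintype F] [DecidableEq F]
    [Fintype ι] [DecidableEq ι] [Fintype σ] {V : Matrix (ι → F) σ ℂ} {J : Finset ι}
    (h : IsAuthorized V J) {ρ ρ' : Matrix σ σ ℂ} (hρ : IsDensity ρ) (hρ' : IsDensity ρ')
    (heq : reducedState J (V * ρ * Vᴴ) = reducedState J (V * ρ' * Vᴴ)) : ρ = ρ' := by
  obtain ⟨R, hR⟩ := h
  rw [← hR ρ hρ, ← hR ρ' hρ', heq]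

/-- Lift from the range of `g` by a linear section, apply `f`, and extend to all of `V₂`; the kernel
condition makes the choice of lift irrelevant. -/
theorem exists_comp_eq_of_ker_le {K V₁ V₂ V₃ : Type*} [Field K] [AddCommGroup V₁]
    [AddCommGroup V₂] [AddCommGroup V₃] [Module K V₁] [Module K V₂] [Module K V₃]
    {g : V₁ →ₗ[K] V₂} {f : V₁ →ₗ[K] V₃} (h : LinearMap.ker g ≤ LinearMap.ker f) :
    ∃ M : V₂ →ₗ[K] V₃, M ∘ₗ g = f := by
  obtain ⟨q, hq⟩ := g.rangeRestrict.exists_rightInverse_of_surjective g.range_rangeRestrict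
  obtain ⟨M, hM⟩ := (f ∘ₗ q).exists_extend
  refine ⟨M, LinearMap.ext fun x => ?_⟩
  have h1 : M (g x) = f (q (g.rangeRestrict x)) := LinearMap.congr_fun hM (g.rangeRestrict x)
  have h2 : g (q (g.rangeRestrict x)) = g x :=
    congrArg Subtype.val (LinearMap.congr_fun hq (g.rangeRestrict x))
  rw [LinearMap.comp_apply, h1]
  exact LinearMap.sub_mem_ker_iff.1 (h (LinearMap.sub_mem_ker_iff.2 h2))

/-! ### Authorized sets of CSS encodings -/

section CSS

variable {F ι k l : Type*} [Field F] [Fintype F] [DecidableEq F] [Fintype ι]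
  [Fintype k] [Fintype l] [DecidableEq l]

theorem cssEncoding_add (A : Matrix k ι F) (B : Matrix l ι F) (x : ι → F) (s s' : k → F) :
    cssEncoding A B x (s + s') = cssEncoding A B (x - Aᵀ *ᵥ s) s' := by
  simp only [cssEncoding, Matrix.mulVec_add]
  congr 1
  refine Finset.sum_congr rfl fun r _ => if_congr ?_ rfl rfl
  rw [sub_eq_iff_eq_add', add_assoc]

theorem cssEncoding_sub_mulVec (A : Matrix k ι F) (B : Matrix l ι F) (x : ι → F) (s : k → F)
    (r : l → F) : cssEncoding A B (x - Bᵀ *ᵥ r) s = cssEncoding A B x s := by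
  simp only [cssEncoding]
  congr 1
  refine Fintype.sum_equiv (Equiv.addRight r) _ _ fun r' => if_congr ?_ rfl rfl
  rw [Equiv.coe_addRight, Matrix.mulVec_add, sub_eq_iff_eq_add, add_assoc]

theorem exists_eq_of_cssEncoding_ne_zero {A : Matrix k ι F} {B : Matrix l ι F} {x : ι → F}
    {s : k → F} (h : cssEncoding A B x s ≠ 0) : ∃ r, x = Aᵀ *ᵥ s + Bᵀ *ᵥ r := by
  contrapose! h
  simp [cssEncoding, h]

/-- The representative of each secret moves by a combination of the rows of `B`, which the sum over
r absorbs. -/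
theorem cssEncoding_sub_mul [DecidableEq k] (A : Matrix k ι F) (B : Matrix l ι F)
    (M : Matrix k l F) : cssEncoding (A - M * B) B = cssEncoding A B := by
  ext x s
  rw [← add_zero s, cssEncoding_add, cssEncoding_add,
    ← cssEncoding_sub_mulVec A B _ _ (- (Mᵀ *ᵥ s))]
  simp only [cssEncoding, Matrix.mulVec_zero, zero_add]
  congr! 4
  rw [Matrix.transpose_sub, Matrix.sub_mulVec, Matrix.transpose_mul, Matrix.mulVec_neg,
    Matrix.mulVec_mulVec]
  abel

/-- By injectivity at most one r contributes at each x, so the inner sum is an indicator and equals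
its own square. -/
theorem sum_cssEncoding_mul_star [DecidableEq ι] (A : Matrix k ι F) (B : Matrix l ι F) (s : k → F)
    (hB : Function.Injective fun r : l → F => Bᵀ *ᵥ r) :
    ∑ x, cssEncoding A B x s * star (cssEncoding A B x s) = 1 := by
  classical
  have key : ∀ x, cssEncoding A B x s * star (cssEncoding A B x s) =
      (Fintype.card (l → F) : ℂ)⁻¹ *
        ∑ r : l → F, if x = Aᵀ *ᵥ s + Bᵀ *ᵥ r then 1 else 0 := by
    intro x
    have hc : ((Real.sqrt (Fintype.card (l → F)) : ℝ) : ℂ)⁻¹ *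
        star ((Real.sqrt (Fintype.card (l → F)) : ℝ) : ℂ)⁻¹ =
        (Fintype.card (l → F) : ℂ)⁻¹ := by
      rw [star_inv₀, Complex.star_def, Complex.conj_ofReal, ← mul_inv, ← Complex.ofReal_mul,
        Real.mul_self_sqrt (by positivity), Complex.ofReal_natCast]
    rw [cssEncoding, star_mul', mul_mul_mul_comm, hc]
    congr 1
    by_cases hx : ∃ r, x = Aᵀ *ᵥ s + Bᵀ *ᵥ r
    · obtain ⟨r, rfl⟩ := hx
      have : ∀ r', Aᵀ *ᵥ s + Bᵀ *ᵥ r = Aᵀ *ᵥ s + Bᵀ *ᵥ r' ↔ r = r' := fun r' =>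
        ⟨fun h => hB (add_left_cancel h), fun h => by rw [h]⟩
      simp [this]
    · push Not at hx
      simp [hx]
  simp only [key]
  rw [← Finset.mul_sum, Finset.sum_comm]
  simp

variable [DecidableEq ι] [DecidableEq k] {A : Matrix k ι F} {B : Matrix l ι F} {J : Finset ι}

/-- Translation by the codeword carries the encoding of 0 to that of s but moves only the traced-out
labels, so the two reductions agree. -/
theorem IsAuthorized.eq_zero_of_codeword (h : IsAuthorized (cssEncoding A B) J) {s : k → F}
    {r : l → F} (hs : ∀ i ∈ J, (Aᵀ *ᵥ s + Bᵀ *ᵥ r) i = 0) : s = 0 := by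
  by_contra hne
  have hV : ∀ x y, cssEncoding A B (glue J x (y + fun i => (Aᵀ *ᵥ s + Bᵀ *ᵥ r) i.1)) s =
      cssEncoding A B (glue J x y) 0 := by
    intro x y
    have hd : glue J x (y + fun i => (Aᵀ *ᵥ s + Bᵀ *ᵥ r) i.1) =
        glue J x y + (Aᵀ *ᵥ s + Bᵀ *ᵥ r) := by
      conv_rhs => rw [← glue_restrict J (Aᵀ *ᵥ s + Bᵀ *ᵥ r), ← glue_add]
      have h0 : (fun i : {i // i ∈ J} => (Aᵀ *ᵥ s + Bᵀ *ᵥ r) i) = 0 :=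
        funext fun i => hs i i.2
      rw [h0, add_zero]
    have hsub : glue J x y + (Aᵀ *ᵥ s + Bᵀ *ᵥ r) - Aᵀ *ᵥ s - Bᵀ *ᵥ r = glue J x y := by abel
    rw [hd]
    nth_rw 2 [← add_zero s]
    rw [cssEncoding_add, ← cssEncoding_sub_mulVec _ _ _ _ r, hsub]
  have heq := h.eq_of_reducedState_eq (isDensity_vecMulVec_single s)
    (isDensity_vecMulVec_single 0) (by
      ext x x'
      simp only [reducedState_conj_apply, Matrix.vecMulVec_apply, Pi.star_apply,
        Pi.single_apply, apply_ite star, star_one, star_zero, ite_mul, mul_ite, one_mul,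
        mul_one, mul_zero, zero_mul, Finset.sum_ite_eq', Finset.mem_univ, if_true]
      refine (Fintype.sum_equiv
        (Equiv.addRight fun i : {i // i ∉ J} => (Aᵀ *ᵥ s + Bᵀ *ᵥ r) i.1) _ _ fun y => ?_).symm
      simp only [Equiv.coe_addRight, hV])
  have := congrFun (congrFun heq s) s
  simp [Matrix.vecMulVec_apply, hne] at this

/-- The discarded qudits alone determine x ⬝ᵥ w, hence s ⬝ᵥ (A *ᵥ w). Coherences between secrets
with different values are lost, so the sign in |0⟩ ± |s⟩ cannot be recovered. -/
theorem IsAuthorized.mulVec_eq_zero (h : IsAuthorized (cssEncoding A B) J) {w : ι → F}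
    (hw : ∀ i ∈ J, w i = 0) (hB : B *ᵥ w = 0) : A *ᵥ w = 0 := by
  by_contra hne
  obtain ⟨s, hs⟩ : ∃ s : k → F, s ⬝ᵥ (A *ᵥ w) ≠ 0 := by
    contrapose! hne
    exact dotProduct_eq_zero _ fun s => by rw [dotProduct_comm, hne]
  have hs0 : (0 : k → F) ≠ s := by
    rintro rfl
    simp at hs
  have hdot : ∀ {x s}, cssEncoding A B x s ≠ 0 → x ⬝ᵥ w = s ⬝ᵥ (A *ᵥ w) := by
    intro x s hx
    obtain ⟨r, rfl⟩ := exists_eq_of_cssEncoding_ne_zero hx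
    rw [add_dotProduct, Matrix.mulVec_transpose, Matrix.mulVec_transpose,
      ← Matrix.dotProduct_mulVec, ← Matrix.dotProduct_mulVec, hB, dotProduct_zero, add_zero]
  have hgl : ∀ x x' y, glue J x y ⬝ᵥ w = glue J x' y ⬝ᵥ w := by
    intro x x' y
    refine Finset.sum_congr rfl fun i _ => ?_
    by_cases hi : i ∈ J
    · simp [hw i hi]
    · simp [glue, hi]
  have hz : ∀ {t t'}, t ⬝ᵥ (A *ᵥ w) ≠ t' ⬝ᵥ (A *ᵥ w) → ∀ x x', ∑ y,
      cssEncoding A B (glue J x y) t * star (cssEncoding A B (glue J x' y) t') = 0 := by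
    intro t t' ht x x'
    refine Finset.sum_eq_zero fun y _ => ?_
    by_contra hy
    apply ht
    rw [← hdot (left_ne_zero_of_mul hy), ← hdot (star_ne_zero.1 (right_ne_zero_of_mul hy))]
    exact hgl x x' y
  have heq := h.eq_of_reducedState_eq
    (isDensity_half_vecMulVec hs0 (c := 1) (by simp))
    (isDensity_half_vecMulVec hs0 (c := -1) (by simp)) (by
      ext x x'
      simp only [reducedState_conj_apply]
      refine Finset.sum_congr rfl fun t _ => Finset.sum_congr rfl fun t' _ => ?_
      -- The two density matrices differ only at the entries (0, s) and (s, 0), where the values are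
      -- distinct and `hz` kills the coefficient.
      by_cases ht : t ⬝ᵥ (A *ᵥ w) = t' ⬝ᵥ (A *ᵥ w)
      · congr 1
        have h1 : ¬ (t = 0 ∧ t' = s) := by
          rintro ⟨rfl, rfl⟩
          exact hs (by rw [← ht, zero_dotProduct])
        have h2 : ¬ (t = s ∧ t' = 0) := by
          rintro ⟨rfl, rfl⟩
          exact hs (by rw [ht, zero_dotProduct])
        simp only [Matrix.smul_apply, Matrix.vecMulVec_apply, Pi.add_apply, Pi.star_apply,
          Pi.single_apply]
        by_cases ha : t = 0 <;> by_cases hb : t = s <;> by_cases hc : t' = 0 <;>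
          by_cases hd : t' = s <;> simp_all
      · rw [hz ht, mul_zero, mul_zero])
  have := congrFun (congrFun heq 0) s
  simp [Matrix.vecMulVec_apply, hs0, hs0.symm] at this
  norm_num [Complex.ext_iff] at this

theorem isAuthorized_of_vanishing (hA : ∀ i ∉ J, ∀ a, A a i = 0)
    (hinj : Function.Injective fun r : l → F => Bᵀ *ᵥ r)
    (hX : ∀ s r, (∀ i ∈ J, (Aᵀ *ᵥ s + Bᵀ *ᵥ r) i = 0) → s = 0) :
    IsAuthorized (cssEncoding A B) J := by
  let res : (ι → F) →ₗ[F] ({i // i ∈ J} → F) := LinearMap.funLeft F F Subtype.val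
  let a : (k → F) →ₗ[F] ({i // i ∈ J} → F) := res ∘ₗ Aᵀ.mulVecLin
  let b : (l → F) →ₗ[F] ({i // i ∈ J} → F) := res ∘ₗ Bᵀ.mulVecLin
  -- `hX` makes `a` injective modulo the range of `b`; hence a linear map that reads s off `a s` and
  -- kills `b`.
  obtain ⟨P₀, hP₀⟩ := ((LinearMap.range b).mkQ ∘ₗ a).exists_leftInverse_of_injective (by
    rw [LinearMap.ker_eq_bot']
    intro s hs
    obtain ⟨r, hr⟩ := (Submodule.Quotient.mk_eq_zero _).1 hs
    refine hX s (-r) fun i hi => ?_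
    have := congrFun hr ⟨i, hi⟩
    simp only [a, b, res, LinearMap.comp_apply, LinearMap.funLeft_apply,
      Matrix.mulVecLin_apply] at this
    simp [Matrix.mulVec_neg, this])
  classical
  let P := P₀ ∘ₗ (LinearMap.range b).mkQ
  have hPa : ∀ s, P (a s) = s := fun s => LinearMap.congr_fun hP₀ s
  have hPb : ∀ r, P (b r) = 0 := by
    intro r
    have : (LinearMap.range b).mkQ (b r) = 0 := by simp
    simp only [P, LinearMap.comp_apply, this, map_zero]
  let f : (k → F) × LinearMap.ker P ≃ ({i // i ∈ J} → F) :=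
    { toFun := fun p => a p.1 + p.2
      invFun := fun x => (P x, ⟨x - a (P x), by simp [hPa]⟩)
      left_inv := by
        rintro ⟨s, t, ht⟩
        rw [LinearMap.mem_ker] at ht
        simp [hPa, ht]
      right_inv := fun x => by simp }
  let u : (ι → F) → ℂ := fun z => cssEncoding A B z 0
  -- Since `A` vanishes off J, removing the secret changes only the labels on J. Applying `P` there
  -- shows that no other secret contributes.
  have hV : ∀ s (t : LinearMap.ker P) y s₀, cssEncoding A B (glue J (f (s, t)) y) s₀ =
      if s₀ = s then u (glue J t y) else 0 := by
    intro s t y s₀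
    have hsub : glue J (f (s, t)) y - Aᵀ *ᵥ s₀ = glue J (a (s - s₀) + t.1) y := by
      ext i
      by_cases hi : i ∈ J
      · simp only [glue, hi, f, a, res, Matrix.mulVec_sub, LinearMap.funLeft_apply,
          Equiv.coe_fn_mk, Pi.sub_apply, Pi.add_apply, LinearMap.comp_apply,
          Matrix.mulVecLin_apply, dif_pos]
        ring
      · simp [glue, hi, Matrix.mulVec, dotProduct, hA i hi]
    rw [← add_zero s₀, cssEncoding_add, hsub, add_zero]
    split_ifs with hs
    · simp [hs, u]
    · by_contra hne
      obtain ⟨r, hr⟩ := exists_eq_of_cssEncoding_ne_zero hne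
      have hr' : a (s - s₀) + t.1 = b r := by
        ext i
        have := congrFun hr i
        simp only [glue, dif_pos i.2, Matrix.mulVec_zero, zero_add] at this
        exact this
      have h1 := congrArg P hr'
      rw [map_add, hPa, hPb, LinearMap.mem_ker.1 t.2, add_zero, sub_eq_zero] at h1
      exact hs h1.symm
  have hone : ∑ t : LinearMap.ker P, ∑ y, u (glue J t y) * star (u (glue J t y)) = 1 := by
    rw [← sum_cssEncoding_mul_star A B 0 hinj, ← sum_glue J, ← f.sum_comp,
      Fintype.sum_prod_type]
    simp only [hV]
    rw [Finset.sum_eq_single (0 : k → F) _ (by simp)]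
    · simp only [if_true]
    · intro s _ hs
      simp [hs.symm]
  refine ⟨discardChannel f, fun ρ _ => ?_⟩
  ext s s'
  rw [discardChannel_apply]
  simp only [reducedState_conj_apply, hV]
  have : ∀ t : LinearMap.ker P, ∑ s₀, ∑ s₀', ρ s₀ s₀' * ∑ y,
      (if s₀ = s then u (glue J t y) else 0) * star (if s₀' = s' then u (glue J t y) else 0) =
      ρ s s' * ∑ y, u (glue J t y) * star (u (glue J t y)) := by
    intro t
    rw [Finset.sum_eq_single s _ (by simp), Finset.sum_eq_single s' _ (by simp)]
    · simp
    · intro c _ hc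
      simp [hc]
    · intro c _ hc
      simp [hc]
  simp only [this]
  rw [← Finset.mul_sum, hone, mul_one]

/-- The set `J` is authorized for a CSS encoding iff no logical operator of type `X` and none of
type `Z` is supported off `J`. -/
theorem isAuthorized_cssEncoding_iff
    (hinj : Function.Injective fun r : l → F => Bᵀ *ᵥ r) :
    IsAuthorized (cssEncoding A B) J ↔
      (∀ s r, (∀ i ∈ J, (Aᵀ *ᵥ s + Bᵀ *ᵥ r) i = 0) → s = 0) ∧
      ∀ w : ι → F, (∀ i ∈ J, w i = 0) → B *ᵥ w = 0 → A *ᵥ w = 0 := by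
  refine ⟨fun h => ⟨fun s r => h.eq_zero_of_codeword, fun w => h.mulVec_eq_zero⟩, ?_⟩
  rintro ⟨hX, hZ⟩
  let W : Submodule F (ι → F) := Submodule.pi (J : Set ι) fun _ => ⊥
  have hW : ∀ w, w ∈ W ↔ ∀ i ∈ J, w i = 0 := fun w => by simp [W, Submodule.mem_pi]
  -- On vectors vanishing on J, `hZ` lets `A` factor through `B`. Then `A - M * B` kills every unit
  -- vector off J, so its columns there are zero.
  obtain ⟨M, hM⟩ : ∃ M : (l → F) →ₗ[F] (k → F),
      M ∘ₗ (B.mulVecLin ∘ₗ W.subtype) = A.mulVecLin ∘ₗ W.subtype := by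
    refine exists_comp_eq_of_ker_le fun w hw => ?_
    exact hZ w ((hW w).1 w.2) hw
  have hM' : ∀ w ∈ W, M (B *ᵥ w) = A *ᵥ w := fun w hw => LinearMap.congr_fun hM ⟨w, hw⟩
  rw [← cssEncoding_sub_mul A B (LinearMap.toMatrix' M)]
  refine isAuthorized_of_vanishing ?_ hinj ?_
  · intro i hi a
    have h1 := hM' (Pi.single i 1) ((hW _).2 fun j hj => by
      rw [Pi.single_eq_of_ne (by rintro rfl; exact hi hj)])
    have h2 : (A - LinearMap.toMatrix' M * B) *ᵥ Pi.single i 1 = 0 := by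
      rw [Matrix.sub_mulVec, ← Matrix.mulVec_mulVec, LinearMap.toMatrix'_mulVec, h1, sub_self]
    simpa using congrFun h2 a
  · intro s r h
    refine hX s (r - (LinearMap.toMatrix' M)ᵀ *ᵥ s) fun i hi => ?_
    rw [← h i hi]
    simp [Matrix.sub_mulVec, Matrix.transpose_mul, Matrix.mulVec_sub]
    ring

end CSS

/-! ### Row spaces, dual codes and relative weights -/

theorem mem_rowSpace {F k ι : Type*} [Field F] [Fintype k] {G : Matrix k ι F} {x : ι → F} :
    x ∈ rowSpace G ↔ ∃ r : k → F, Gᵀ *ᵥ r = x := by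
  rw [rowSpace, Submodule.mem_span_range_iff_exists_fun]
  refine exists_congr fun r => ?_
  rw [Matrix.mulVec_transpose, Matrix.vecMul_eq_sum]
  rfl

theorem transpose_mulVec_mem_rowSpace {F k ι : Type*} [Field F] [Fintype k]
    (G : Matrix k ι F) (r : k → F) : Gᵀ *ᵥ r ∈ rowSpace G :=
  mem_rowSpace.2 ⟨r, rfl⟩

theorem eq_zero_of_transpose_mulVec_eq_zero {F k ι : Type*} [Field F] [Fintype k]
    {G : Matrix k ι F} (hG : LinearIndependent F G.row) {r : k → F} (h : Gᵀ *ᵥ r = 0) :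
    r = 0 := by
  rw [Matrix.mulVec_transpose] at h
  exact Matrix.vecMul_injective_iff.2 hG (h.trans (Matrix.zero_vecMul G).symm)

theorem mem_dualCode {F ι : Type*} [Field F] [Fintype ι] {C : Submodule F (ι → F)}
    {x : ι → F} : x ∈ dualCode C ↔ ∀ c ∈ C, x ⬝ᵥ c = 0 :=
  Iff.rfl

theorem mem_dualCode_rowSpace {F k ι : Type*} [Field F] [Fintype ι] [Fintype k]
    {G : Matrix k ι F} {x : ι → F} : x ∈ dualCode (rowSpace G) ↔ G *ᵥ x = 0 := by
  rw [mem_dualCode]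
  constructor
  · intro h
    refine dotProduct_eq_zero _ fun r => ?_
    rw [dotProduct_comm, Matrix.dotProduct_mulVec, ← Matrix.mulVec_transpose, dotProduct_comm]
    exact h _ (transpose_mulVec_mem_rowSpace G r)
  · intro h c hc
    obtain ⟨r, rfl⟩ := mem_rowSpace.1 hc
    rw [dotProduct_comm, Matrix.mulVec_transpose, ← Matrix.dotProduct_mulVec, h,
      dotProduct_zero]

theorem mem_dualCode_sup {F ι : Type*} [Field F] [Fintype ι] {C D : Submodule F (ι → F)}
    {x : ι → F} : x ∈ dualCode (C ⊔ D) ↔ x ∈ dualCode C ∧ x ∈ dualCode D := by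
  refine ⟨fun h => ⟨fun c hc => h c (Submodule.mem_sup_left hc),
    fun c hc => h c (Submodule.mem_sup_right hc)⟩, fun h c hc => ?_⟩
  obtain ⟨a, ha, b, hb, rfl⟩ := Submodule.mem_sup.1 hc
  rw [dotProduct_add, h.1 a ha, h.2 b hb, add_zero]

/-- A functional that kills D but not c is the dot product with its vector of values on the unit
vectors. -/
theorem le_of_dualCode_le {F ι : Type*} [Field F] [Fintype ι] {C D : Submodule F (ι → F)}
    (h : dualCode D ≤ dualCode C) : C ≤ D := by
  classical
  intro c hc
  by_contra hcD
  obtain ⟨φ, hφ, hD⟩ := Submodule.exists_le_ker_of_notMem hcD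
  have hdot : ∀ x, (fun i => φ (Pi.single i 1)) ⬝ᵥ x = φ x := fun x => by
    conv_rhs => rw [← Finset.univ_sum_single x, map_sum]
    refine Finset.sum_congr rfl fun i _ => ?_
    rw [mul_comm, ← smul_eq_mul, ← map_smul]
    simp [← Pi.single_smul]
  exact hφ ((hdot c).symm.trans (h (fun d hd => (hdot d).trans (hD hd)) c hc))

/-- A word is missed by J iff J lies in its zero set, which is largest at minimum weight. The
hypothesis `h` ensures that the infimum is attained and is not the default value 0. For τ beyond the
length both sides hold, the left one vacuously. -/
theorem forall_exists_ne_zero_iff_lt_wtDiff {F ι : Type*} [Field F] [DecidableEq F] [Fintype ι]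
    {C₀ C₁ : Submodule F (ι → F)} (h : ¬ C₀ ≤ C₁) (τ : ℕ) :
    (∀ J : Finset ι, J.card = τ → ∀ c ∈ C₀, c ∉ C₁ → ∃ i ∈ J, c i ≠ 0) ↔
      Fintype.card ι < wtDiff C₀ C₁ + τ := by
  classical
  have hcard : ∀ c : ι → F,
      (Finset.univ.filter fun i => c i = 0).card + hammingNorm c = Fintype.card ι := fun c =>
    Finset.card_filter_add_card_filter_not (s := Finset.univ) (fun i => c i = 0)
  constructor
  · intro hJ
    by_contra! hle
    obtain ⟨c₀, hc₀, hc₁⟩ := SetLike.not_le_iff_exists.1 h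
    obtain ⟨c, hc, hc', hw⟩ := Nat.sInf_mem
      (s := {w : ℕ | ∃ c : ι → F, c ∈ C₀ ∧ c ∉ C₁ ∧ hammingNorm c = w}) ⟨_, c₀, hc₀, hc₁, rfl⟩
    change hammingNorm c = wtDiff C₀ C₁ at hw
    obtain ⟨J, hJs, hJc⟩ := Finset.exists_subset_card_eq
      (s := Finset.univ.filter fun i => c i = 0) (n := τ) (by have := hcard c; omega)
    obtain ⟨i, hi, hne⟩ := hJ J hJc c hc hc'
    exact hne (Finset.mem_filter.1 (hJs hi)).2
  · intro hlt J hJ c hc hc'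
    by_contra! hz
    have h1 : wtDiff C₀ C₁ ≤ hammingNorm c := Nat.sInf_le ⟨c, hc, hc', rfl⟩
    have h2 : J.card ≤ (Finset.univ.filter fun i => c i = 0).card :=
      Finset.card_le_card fun i hi => by simp [hz i hi]
    have := hcard c
    omega

/-! ### Authorized sets of extended CSS encodings -/

theorem injective_fromBlocks_transpose_mulVec {F : Type*} [Field F] {n e f : ℕ}
    {B : Matrix (Fin f) (Fin n) F}
    (hB : LinearIndependent F B.row) (GE : Matrix (Fin e) (Fin n) F) :
    Function.Injective fun r : Fin f ⊕ Fin e → F =>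
      (Matrix.fromBlocks B 0 GE (1 : Matrix (Fin e) (Fin e) F))ᵀ *ᵥ r := by
  refine (injective_iff_map_eq_zero
    ((Matrix.fromBlocks B 0 GE (1 : Matrix (Fin e) (Fin e) F))ᵀ.mulVecLin)).2 fun r hr => ?_
  rw [Matrix.mulVecLin_apply, Matrix.fromBlocks_transpose, Matrix.fromBlocks_mulVec] at hr
  have h2 : r ∘ Sum.inr = 0 := by
    ext i
    simpa using congrFun hr (Sum.inr i)
  have h1 : r ∘ Sum.inl = 0 := by
    refine eq_zero_of_transpose_mulVec_eq_zero hB (funext fun i => ?_)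
    have := congrFun hr (Sum.inl i)
    rwa [Sum.elim_inl, h2, Matrix.mulVec_zero, add_zero] at this
  ext i
  cases i with
  | inl i => exact congrFun h1 i
  | inr i => exact congrFun h2 i

theorem isAuthorized_ecssEncoding_iff {F : Type*} [Field F] [Fintype F] [DecidableEq F]
    {n e m f : ℕ} {F₀ F₁ : Submodule F (Fin n → F)}
    {GE : Matrix (Fin e) (Fin n) F} (hE : F₀ ⊓ rowSpace GE = ⊥)
    {A : Matrix (Fin m) (Fin n) F} (hA : IsQuotientGeneratorMatrix A F₀ F₁)
    {B : Matrix (Fin f) (Fin n) F} (hB : IsGeneratorMatrix B F₁) (J : Finset (Fin n)) :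
    IsAuthorized (ecssEncoding A B GE) (J.map Function.Embedding.inl) ↔
      (∀ c ∈ F₀ ⊔ rowSpace GE, c ∉ F₁ ⊔ rowSpace GE → ∃ i ∈ J, c i ≠ 0) ∧
      ∀ c ∈ dualCode F₁, c ∉ dualCode F₀ → ∃ i ∈ J, c i ≠ 0 := by
  obtain ⟨hBi, rfl⟩ := hB
  obtain ⟨_, hinf, rfl, hAi, rfl⟩ := hA
  have hX : ∀ (s : Fin m → F) (r : Fin f ⊕ Fin e → F) (i : Fin n),
      ((Matrix.fromCols A (0 : Matrix (Fin m) (Fin e) F))ᵀ *ᵥ s +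
        (Matrix.fromBlocks B 0 GE (1 : Matrix (Fin e) (Fin e) F))ᵀ *ᵥ r) (Sum.inl i) =
      (Bᵀ *ᵥ (r ∘ Sum.inl) + Aᵀ *ᵥ s + GEᵀ *ᵥ (r ∘ Sum.inr)) i := by
    intro s r i
    rw [Matrix.transpose_fromCols, Matrix.fromRows_mulVec, Matrix.fromBlocks_transpose,
      Matrix.fromBlocks_mulVec]
    simp only [Pi.add_apply, Sum.elim_inl]
    ring
  rw [ecssEncoding, isAuthorized_cssEncoding_iff (injective_fromBlocks_transpose_mulVec hBi GE)]
  simp only [Finset.mem_map, forall_exists_index, and_imp, forall_apply_eq_imp_iff₂,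
    Function.Embedding.inl_apply, hX]
  refine and_congr ⟨fun h c hc hc' => ?_, fun h s r hs => ?_⟩
    ⟨fun h y hy hy' => ?_, fun h w hw hBw => ?_⟩
  · obtain ⟨c₀, hc₀, c₂, hc₂, rfl⟩ := Submodule.mem_sup.1 hc
    obtain ⟨c₁, hc₁, d, hd, rfl⟩ := Submodule.mem_sup.1 hc₀
    obtain ⟨r₁, rfl⟩ := mem_rowSpace.1 hc₁
    obtain ⟨s, rfl⟩ := mem_rowSpace.1 hd
    obtain ⟨r₂, rfl⟩ := mem_rowSpace.1 hc₂
    by_contra! hz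
    have hs := h s (Sum.elim r₁ r₂) (by simpa only [Sum.elim_comp_inl, Sum.elim_comp_inr])
    rw [hs, Matrix.mulVec_zero, add_zero] at hc'
    exact hc' (Submodule.add_mem_sup hc₁ hc₂)
  · by_contra hs0
    have hr₁ := transpose_mulVec_mem_rowSpace B (r ∘ Sum.inl)
    have hr₂ := transpose_mulVec_mem_rowSpace GE (r ∘ Sum.inr)
    have hAs := transpose_mulVec_mem_rowSpace A s
    obtain ⟨i, hi, hne⟩ := h _ (Submodule.add_mem_sup (Submodule.add_mem_sup hr₁ hAs) hr₂) (by
      intro hmem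
      obtain ⟨c₁, hc₁, c₂, hc₂, heq⟩ := Submodule.mem_sup.1 hmem
      -- Triviality of F₀ ∩ E splits off the E part; then `hinf` separates the rows of `A` from
      -- those of `B`.
      have h1 : Bᵀ *ᵥ (r ∘ Sum.inl) + Aᵀ *ᵥ s - c₁ ∈ (rowSpace B ⊔ rowSpace A) ⊓ rowSpace GE := by
        refine ⟨sub_mem (Submodule.add_mem_sup hr₁ hAs) (Submodule.mem_sup_left hc₁), ?_⟩
        have : Bᵀ *ᵥ (r ∘ Sum.inl) + Aᵀ *ᵥ s - c₁ = c₂ - GEᵀ *ᵥ (r ∘ Sum.inr) := by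
          rw [sub_eq_sub_iff_add_eq_add, ← heq, add_comm]
        rw [this]
        exact sub_mem hc₂ hr₂
      rw [hE, Submodule.mem_bot] at h1
      have h2 : Aᵀ *ᵥ s ∈ rowSpace B ⊓ rowSpace A := by
        refine ⟨?_, hAs⟩
        have : Aᵀ *ᵥ s = c₁ - Bᵀ *ᵥ (r ∘ Sum.inl) := by
          rw [eq_sub_iff_add_eq', ← sub_eq_zero, h1]
        rw [this]
        exact sub_mem hc₁ hr₁
      rw [hinf, Submodule.mem_bot] at h2
      exact hs0 (eq_zero_of_transpose_mulVec_eq_zero hAi h2))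
    exact hne (hs i hi)
  · by_contra! hz
    rw [mem_dualCode_rowSpace] at hy
    rw [mem_dualCode_sup, mem_dualCode_rowSpace, mem_dualCode_rowSpace] at hy'
    refine hy' ⟨hy, ?_⟩
    -- The extension part -(GE *ᵥ y) is forced by the block row [G_E I]; it costs nothing, as J
    -- contains no extension qudit.
    have := h (Sum.elim y (-(GE *ᵥ y))) (by simpa using hz) (by
      ext i
      cases i <;> simp [Matrix.fromBlocks_mulVec, hy])
    simpa [Matrix.fromCols_mulVec] using this
  · rw [Matrix.fromBlocks_mulVec] at hBw
    have hB0 : B *ᵥ (w ∘ Sum.inl) = 0 := funext fun i => by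
      simpa using congrFun hBw (Sum.inl i)
    rw [Matrix.fromCols_mulVec, Matrix.zero_mulVec, add_zero]
    by_contra hA0
    obtain ⟨i, hi, hne⟩ := h (w ∘ Sum.inl) (mem_dualCode_rowSpace.2 hB0) (by
      rw [mem_dualCode_sup, mem_dualCode_rowSpace, mem_dualCode_rowSpace]
      exact fun h => hA0 h.2)
    exact hne (hw i hi)

end ExtendedCSS

end

theorem mainTheorem7 {F : Type*} [Field F] [Fintype F] [DecidableEq F] {n e m f : ℕ}
    (F₀ F₁ : Submodule F (Fin n → F)) (GE : Matrix (Fin e) (Fin n) F)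
    (hF : F₁ < F₀) (hE : F₀ ⊓ ExtendedCSS.rowSpace GE = ⊥)
    (A : Matrix (Fin m) (Fin n) F) (hA : ExtendedCSS.IsQuotientGeneratorMatrix A F₀ F₁)
    (B : Matrix (Fin f) (Fin n) F) (hB : ExtendedCSS.IsGeneratorMatrix B F₁) (τ : ℕ) :
    (∀ J : Finset (Fin n), J.card = τ →
        ExtendedCSS.IsAuthorized (ExtendedCSS.ecssEncoding A B GE)
          (J.map Function.Embedding.inl)) ↔
      (n : ℤ) - min (ExtendedCSS.wtDiff (F₀ ⊔ ExtendedCSS.rowSpace GE)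
            (F₁ ⊔ ExtendedCSS.rowSpace GE) : ℤ)
          (ExtendedCSS.wtDiff (ExtendedCSS.dualCode F₁) (ExtendedCSS.dualCode F₀) : ℤ) + 1
        ≤ (τ : ℤ) := by
  have hX : ¬ F₀ ⊔ ExtendedCSS.rowSpace GE ≤ F₁ ⊔ ExtendedCSS.rowSpace GE := by
    intro h
    refine hF.not_ge fun c hc => ?_
    obtain ⟨a, ha, b, hb, rfl⟩ := Submodule.mem_sup.1 (h (Submodule.mem_sup_left hc))
    have : b ∈ F₀ ⊓ ExtendedCSS.rowSpace GE :=
      ⟨by simpa using sub_mem hc (hF.le ha), hb⟩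
    rw [hE, Submodule.mem_bot] at this
    rwa [this, add_zero]
  have hZ : ¬ ExtendedCSS.dualCode F₁ ≤ ExtendedCSS.dualCode F₀ := fun h =>
    hF.not_ge (ExtendedCSS.le_of_dualCode_le h)
  have h1 := ExtendedCSS.forall_exists_ne_zero_iff_lt_wtDiff hX τ
  have h2 := ExtendedCSS.forall_exists_ne_zero_iff_lt_wtDiff hZ τ
  rw [Fintype.card_fin] at h1 h2
  simp only [ExtendedCSS.isAuthorized_ecssEncoding_iff hE hA hB, forall_and, h1, h2]
  omega
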